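/- All graphs are finite and simple. Let $G$ be a connected, non-bipartite graph with $V(G)=\{1,\dots,n\}$ that does not have two edge-disjoint cycles of odd length connected by a path (a path with two distinct ends, one of which is its only vertex on the first cycle and the other its only vertex on the second cycle). Let $s_i$ ($1\le i\le n$) and $a_e\le b_e$ ($e\in E(G)$) be integers. Let $f_1,\dots,f_n$ be the standard basis of $\mathbb{Z}^n$ and put $v(e)=f_i+f_j$ for an edge $e=ij$. Then there exist integers $x_e$ with $a_e\le x_e\le b_e$ ($e\in E(G)$) such that $$\sum_{i=1}^n s_i f_i=\sum_{e\in E(G)} x_e\, v(e)$$ if and only if $\sum_{i=1}^n s_i$ is even and, for all disjoint sets $I,J\subset\{1,\dots,n\}$ such that the subgraph of $G$ with vertex set $I\cup J$ and edge set $\{ij\in E(G) : i\in I,\ j\in J\}$ is a (nonempty) connected graph and no connected component of $G-(I\cup J)$ is bipartite, we have $$\sum_{i\in I}s_i-\sum_{j\in J}s_j\ \le \sum_{e=ij,\ i\in I,\ j\notin I\cup J} b_e+2\sum_{e=ij,\ i,j\in I} b_e-\sum_{e=ij,\ i\notin I\cup J,\ j\in J} a_e-2\sum_{e=ij,\ i,j\in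 J} a_e .$$ -/

import Mathlib

/-- The vector `v(e) = f_i + f_j` of an edge `e = ij`, where `f_i` is the standard basis;
it is the column of the incidence matrix belonging to `e`. -/
def edgeVector {V : Type*} [DecidableEq V] (e : Sym2 V) : V → ℤ :=
  Sym2.lift ⟨fun i j => Pi.single i 1 + Pi.single j 1, fun _ _ => add_comm _ _⟩ e

/-- `G` has two edge-disjoint odd cycles `C`, `D` connected by a path `P`: the path has two
different ends, one of which is its only vertex on `C`, the other its only vertex on `D`. -/
def HasConnectedOddCycles {V : Type*} (G : SimpleGraph V) : Prop :=
  ∃ (c d u v : V) (C : G.Walk c c) (D : G.Walk d d) (P : G.Walk u v),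
    C.IsCycle ∧ Odd C.length ∧ D.IsCycle ∧ Odd D.length ∧ C.edges.Disjoint D.edges ∧
    P.IsPath ∧ u ≠ v ∧ u ∈ C.support ∧ v ∈ D.support ∧
    (∀ x ∈ P.support, x ∈ C.support → x = u) ∧
    (∀ x ∈ P.support, x ∈ D.support → x = v)

/-- The subgraph of `G` with vertex set `I ∪ J` and edge set `{ij ∈ E(G) | i ∈ I, j ∈ J}`. -/
def crossSubgraph {V : Type*} [DecidableEq V] (G : SimpleGraph V) (I J : Finset V) :
    G.Subgraph where
  verts := {x | x ∈ I ∪ J}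
  Adj x y := G.Adj x y ∧ ((x ∈ I ∧ y ∈ J) ∨ (x ∈ J ∧ y ∈ I))
  adj_sub h := h.1
  edge_vert := by
    rintro x y ⟨-, h | h⟩
    · exact Finset.mem_union_left _ h.1
    · exact Finset.mem_union_right _ h.1
  symm := ⟨fun _ _ h => ⟨h.1.symm, h.2.symm.imp And.symm And.symm⟩⟩

/-- The edges `e = ij` of `G` with `i ∈ A` and `j ∈ B` (each edge occurs once). -/
def edgesBetween {V : Type*} [Fintype V] [DecidableEq V] (G : SimpleGraph V)
    [DecidableRel G.Adj] (A B : Finset V) : Finset G.edgeSet :=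
  Finset.univ.filter fun e => ∃ i ∈ A, ∃ j ∈ B, (e : Sym2 V) = s(i, j)

/-!
If no real `x` in the box `[a, b]` has `A *ᵥ x = s`, where `A` is the vertex-edge incidence matrix,
then some `y` separates: the support function of the box at `y ᵥ* A` is less than `y ⬝ᵥ s`. That
function is additive on vectors of the same sign pattern, so `y ᵥ* A` can be taken elementary. The
vector with entries `sign (y v)` where `|y v|` is largest and `0` elsewhere conforms to `y ᵥ* A`, so
`y` is a positive multiple of it, that is, of `1_I - 1_J`. Restricting `1_I - 1_J` to a component of
the graph of the `I`-`J` edges, or adding a signing of a bipartite component of `G - (I ∪ J)`, gives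
another conforming vector, so by elementarity the former graph is connected and the latter component
does not exist.

For integrality, take a real solution with the fewest fractional entries. The columns of `A` at
these entries are independent, so an even closed walk along fractional edges has alternating sum
zero. Hence fractional cycles are odd, and two of them have the same edges, since they meet in a
vertex: disjoint ones would be joined by a shortest path. Adding `t` times the alternating sum of
such a cycle makes one of its edges integral and leaves a forest of fractional edges, from whose
leaves integrality propagates. As `∑ v, s v` is even, `t` is an integer, so the solution was
integral.
-/

section Box

variable {ι R : Type*}

/-- `q` conforms to `p` if `q` agrees in sign with `p` wherever `q` does not vanish. These are the
conformal vectors of oriented matroid theory. -/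
def IsConformal [Zero R] [LT R] (q p : ι → R) : Prop :=
  ∀ e, (0 < q e → 0 < p e) ∧ (q e < 0 → p e < 0)

namespace IsConformal

theorem trans [Zero R] [LT R] {r q p : ι → R} (hrq : IsConformal r q) (hqp : IsConformal q p) :
    IsConformal r p :=
  fun e => ⟨fun h => (hqp e).1 ((hrq e).1 h), fun h => (hqp e).2 ((hrq e).2 h)⟩

theorem const_smul_left [Semiring R] [LinearOrder R] [IsStrictOrderedRing R] {q p : ι → R}
    (h : IsConformal q p) {c : R} (hc : 0 < c) : IsConformal (c • q) p := by
  simpa [IsConformal, smul_neg_iff_of_pos_left hc, hc, -smul_eq_mul] using h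

theorem mul_nonneg [Ring R] [LinearOrder R] [IsStrictOrderedRing R] {q r p : ι → R}
    (hq : IsConformal q p) (hr : IsConformal r p) (e : ι) : 0 ≤ q e * r e := by
  rcases lt_trichotomy (q e) 0 with h | h | h
  · exact mul_nonneg_of_nonpos_of_nonpos h.le
      (not_lt.mp fun hlt => ((hq e).2 h).not_gt ((hr e).1 hlt))
  · simp [h]
  · exact _root_.mul_nonneg h.le (not_lt.mp fun hlt => ((hq e).1 h).not_gt ((hr e).2 hlt))

/-- Subtract the largest multiple of `q` that keeps all signs of `p`. -/
theorem exists_sub_smul [Finite ι] [Field R] [LinearOrder R] [IsStrictOrderedRing R] {q p : ι → R}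
    (hqp : IsConformal q p) (hq : q ≠ 0) :
    ∃ c : R, 0 < c ∧ IsConformal (p - c • q) p ∧ ∃ e, p e ≠ 0 ∧ (p - c • q) e = 0 := by
  obtain ⟨e₀, he₀ : q e₀ ≠ 0, hmin⟩ := Set.exists_min_image {e | q e ≠ 0} (fun e => p e / q e)
    (Set.toFinite _) (Function.ne_iff.mp hq)
  have hc : 0 < p e₀ / q e₀ := by
    rcases lt_or_gt_of_ne he₀ with h | h
    · exact div_pos_of_neg_of_neg ((hqp e₀).2 h) h
    · exact div_pos ((hqp e₀).1 h) h
  refine ⟨p e₀ / q e₀, hc, fun e => ?_, e₀, (div_ne_zero_iff.mp hc.ne').1, by simp [he₀]⟩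
  simp only [Pi.sub_apply, Pi.smul_apply, smul_eq_mul, sub_pos, sub_neg]
  rcases lt_trichotomy (q e) 0 with h | h | h
  · have hle := (le_div_iff_of_neg h).mp (hmin e h.ne)
    exact ⟨fun h' => absurd hle h'.not_ge, fun _ => (hqp e).2 h⟩
  · simp [h]
  · have hle := (le_div_iff₀ h).mp (hmin e h.ne')
    exact ⟨fun _ => (hqp e).1 h, fun h' => absurd hle h'.not_ge⟩

end IsConformal

variable [Fintype ι]

/-- The support function of the box `[a, b]`: the maximum of `x ⬝ᵥ u` over `a ≤ x ≤ b`. -/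
def boxSupport [Ring R] [LinearOrder R] (a b u : ι → R) : R :=
  ∑ e, (b e * (u e)⁺ - a e * (u e)⁻)

open Matrix

section OrderedRing

variable [Ring R] [LinearOrder R] [IsStrictOrderedRing R] {a b u v : ι → R}

theorem boxSupport_add (h : ∀ e, 0 ≤ u e * v e) :
    boxSupport a b (u + v) = boxSupport a b u + boxSupport a b v := by
  rw [boxSupport, boxSupport, boxSupport, ← Finset.sum_add_distrib]
  refine Finset.sum_congr rfl fun e _ => ?_
  rcases nonneg_and_nonneg_or_nonpos_and_nonpos_of_mul_nonneg (h e) with ⟨hu, hv⟩ | ⟨hu, hv⟩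
  · simp [posPart_of_nonneg, negPart_of_nonneg, hu, hv, add_nonneg, mul_add]
  · simp only [Pi.add_apply, posPart_of_nonpos, negPart_of_nonpos, hu, hv, add_nonpos]
    noncomm_ring

theorem dotProduct_le_boxSupport {x : ι → R} (hx : x ∈ Set.Icc a b) :
    x ⬝ᵥ u ≤ boxSupport a b u := by
  refine Finset.sum_le_sum fun e _ => ?_
  calc x e * u e = x e * (u e)⁺ - x e * (u e)⁻ := by rw [← mul_sub, posPart_sub_negPart]
    _ ≤ b e * (u e)⁺ - a e * (u e)⁻ :=
      sub_le_sub (mul_le_mul_of_nonneg_right (hx.2 e) (posPart_nonneg _))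
        (mul_le_mul_of_nonneg_right (hx.1 e) (negPart_nonneg _))

theorem exists_dotProduct_eq_boxSupport (hab : a ≤ b) (u : ι → R) :
    ∃ x ∈ Set.Icc a b, x ⬝ᵥ u = boxSupport a b u := by
  refine ⟨fun e => if 0 ≤ u e then b e else a e,
    ⟨fun e => ?_, fun e => ?_⟩, Finset.sum_congr rfl fun e _ => ?_⟩
  · dsimp only; split_ifs <;> simp [hab e]
  · dsimp only; split_ifs <;> simp [hab e]
  · dsimp only
    split_ifs with h
    · simp [posPart_of_nonneg h, negPart_of_nonneg h]
    · simp [posPart_of_nonpos (not_le.mp h).le, negPart_of_nonpos (not_le.mp h).le]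

end OrderedRing

theorem boxSupport_smul [CommRing R] [LinearOrder R] [IsStrictOrderedRing R] {c : R} (hc : 0 ≤ c)
    (a b u : ι → R) : boxSupport a b (c • u) = c * boxSupport a b u := by
  rw [boxSupport, boxSupport, Finset.mul_sum]
  refine Finset.sum_congr rfl fun e _ => ?_
  rcases le_total 0 (u e) with h | h
  · simp [posPart_of_nonneg, negPart_of_nonneg, h, mul_nonneg hc h, mul_left_comm]
  · simp [posPart_of_nonpos, negPart_of_nonpos, h, mul_nonpos_of_nonneg_of_nonpos hc h,
      mul_left_comm]

variable {V : Type*} [Fintype V]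

theorem exists_boxSupport_vecMul_lt (A : Matrix V ι ℝ) {a b : ι → ℝ} (hab : a ≤ b) {s : V → ℝ}
    (hs : ∀ x ∈ Set.Icc a b, A *ᵥ x ≠ s) : ∃ y : V → ℝ, boxSupport a b (y ᵥ* A) < y ⬝ᵥ s := by
  classical
  have hclosed : IsClosed (A.mulVecLin '' Set.Icc a b) :=
    (isCompact_Icc.image A.mulVecLin.continuous_of_finiteDimensional).isClosed
  have hconvex : Convex ℝ (A.mulVecLin '' Set.Icc a b) := (convex_Icc a b).linear_image _
  obtain ⟨f, t, hlt, hgt⟩ := geometric_hahn_banach_closed_point hconvex hclosed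
    (fun ⟨x, hx, hxs⟩ => hs x hx hxs)
  obtain ⟨y, hy⟩ := (dotProductEquiv ℝ V).surjective f.toLinearMap
  have hf : ∀ w, f w = y ⬝ᵥ w := fun w => (LinearMap.congr_fun hy w).symm
  obtain ⟨x, hx, hxy⟩ := exists_dotProduct_eq_boxSupport hab (y ᵥ* A)
  refine ⟨y, ?_⟩
  calc boxSupport a b (y ᵥ* A) = f (A *ᵥ x) := by
        rw [← hxy, hf, dotProduct_comm, dotProduct_mulVec]
    _ < t := hlt _ ⟨x, hx, rfl⟩
    _ < y ⬝ᵥ s := by rw [← hf]; exact hgt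

/-- An elementary vector `y ᵥ* A` of the row space of `A`, recorded through its coefficients `y`:
up to positive scaling, nothing else conforms to it. -/
def IsElementary [Semiring R] [LT R] (A : Matrix V ι R) (y : V → R) : Prop :=
  ∀ z ≠ 0, IsConformal (z ᵥ* A) (y ᵥ* A) → ∃ c : R, 0 < c ∧ y = c • z

variable [Field R] [LinearOrder R] [IsStrictOrderedRing R] {A : Matrix V ι R}

omit [Fintype ι] in
theorem IsElementary.of_isConformal {y z : V → R} (hy : IsElementary A y) (hz : z ≠ 0)
    (hzy : IsConformal (z ᵥ* A) (y ᵥ* A)) : IsElementary A z := by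
  intro w hw hwz
  obtain ⟨c, hc, rfl⟩ := hy z hz hzy
  obtain ⟨d, hd, h⟩ := hy w hw (hwz.trans hzy)
  exact ⟨c⁻¹ * d, by positivity, by rw [mul_smul, ← h, inv_smul_smul₀ hc.ne']⟩

theorem exists_isElementary_boxSupport_lt (hA : ∀ y, y ᵥ* A = 0 → y = 0) {a b : ι → R} {s : V → R}
    (hs : ∃ y, boxSupport a b (y ᵥ* A) < y ⬝ᵥ s) :
    ∃ y, IsElementary A y ∧ boxSupport a b (y ᵥ* A) < y ⬝ᵥ s := by
  obtain ⟨y, hy, hmin⟩ := exists_minimalFor_of_wellFoundedLT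
    (fun y => boxSupport a b (y ᵥ* A) < y ⬝ᵥ s) (fun y => Function.support (y ᵥ* A)) hs
  have split : ∀ z ≠ 0, IsConformal (z ᵥ* A) (y ᵥ* A) →
      boxSupport a b (z ᵥ* A) < z ⬝ᵥ s ∧ ∃ c : R, 0 < c ∧
        IsConformal ((y - c • z) ᵥ* A) (y ᵥ* A) ∧
        ¬ boxSupport a b ((y - c • z) ᵥ* A) < (y - c • z) ⬝ᵥ s := by
    intro z hz hzy
    obtain ⟨c, hc, hconf, e, he, he'⟩ := hzy.exists_sub_smul (mt (hA z) hz)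
    rw [← smul_vecMul, ← sub_vecMul] at hconf he'
    have hnot : ¬ boxSupport a b ((y - c • z) ᵥ* A) < (y - c • z) ⬝ᵥ s := fun hlt => by
      refine hmin hlt (fun i hi => ?_) he he'
      rcases lt_or_gt_of_ne hi with h | h
      · exact ((hconf i).2 h).ne
      · exact ((hconf i).1 h).ne'
    have hadd := boxSupport_add (a := a) (b := b) (hconf.mul_nonneg (hzy.const_smul_left hc))
    rw [← smul_vecMul, ← add_vecMul, sub_add_cancel, smul_vecMul, boxSupport_smul hc.le] at hadd
    refine ⟨lt_of_mul_lt_mul_left ?_ hc.le, c, hc, hconf, hnot⟩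
    rw [sub_dotProduct, smul_dotProduct, smul_eq_mul] at hnot
    linarith
  refine ⟨y, fun z hz hzy => ?_, hy⟩
  obtain ⟨-, c, hc, hconf, hnot⟩ := split z hz hzy
  refine ⟨c, hc, sub_eq_zero.mp ?_⟩
  by_contra hne
  exact hnot (split _ hne hconf).1

end Box

section Cut

variable {V : Type*} [DecidableEq V]

/-- The incidence matrix of `G` with columns indexed by the edges only, so that its columns are the
vectors `edgeVector e`. Mathlib's `SimpleGraph.incMatrix` also has a column for each non-edge. -/
def edgeIncMatrix (R : Type*) [Ring R] (G : SimpleGraph V) : Matrix V G.edgeSet R :=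
  Matrix.of fun v e => (edgeVector (e : Sym2 V) v : R)

/-- The vector with entries `1` on `I`, `-1` on `J` and `0` elsewhere. -/
def signVec (R : Type*) [Ring R] (I J : Finset V) (v : V) : R :=
  (if v ∈ I then 1 else 0) - (if v ∈ J then 1 else 0)

open Matrix

variable {R : Type*} {G : SimpleGraph V}

omit [DecidableEq V] in
theorem forall_edgeSet_iff {P : G.edgeSet → Prop} :
    (∀ e, P e) ↔ ∀ (i j : V) (h : G.Adj i j), P ⟨s(i, j), h⟩ :=
  ⟨fun H _ _ _ => H _, fun H ⟨e, he⟩ => by induction e with | h i j => exact H i j he⟩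

theorem edgeIncMatrix_apply [Ring R] (v : V) {i j : V} (h : G.Adj i j) :
    edgeIncMatrix R G v ⟨s(i, j), h⟩ = (Pi.single i 1 + Pi.single j 1 : V → R) v := by
  simp [edgeIncMatrix, edgeVector, Pi.single_apply]

theorem edgeIncMatrix_apply_of_notMem [Ring R] {v : V} {e : Sym2 V}
    (he : e ∈ G.edgeSet) (hv : v ∉ e) :
    edgeIncMatrix R G v ⟨e, he⟩ = 0 := by
  induction e with | h i j => ?_
  rw [Sym2.mem_iff, not_or] at hv
  simp [edgeIncMatrix_apply v he, hv.1, hv.2]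

variable [Fintype V]

theorem vecMul_edgeIncMatrix [Ring R] (y : V → R) {i j : V} (h : G.Adj i j) :
    (y ᵥ* edgeIncMatrix R G) ⟨s(i, j), h⟩ = y i + y j := by
  simp [edgeIncMatrix, edgeVector, vecMul, dotProduct, Pi.single_apply, mul_add,
    Finset.sum_add_distrib]

theorem isConformal_vecMul_edgeIncMatrix [Ring R] [LT R] {z y : V → R} :
    IsConformal (z ᵥ* edgeIncMatrix R G) (y ᵥ* edgeIncMatrix R G) ↔
      ∀ i j, G.Adj i j → (0 < z i + z j → 0 < y i + y j) ∧ (z i + z j < 0 → y i + y j < 0) := by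
  simp only [IsConformal, forall_edgeSet_iff, vecMul_edgeIncMatrix]

theorem eq_zero_of_vecMul_edgeIncMatrix_eq_zero [Ring R] [LinearOrder R] [IsStrictOrderedRing R]
    (hconn : G.Connected) (hnb : ¬ G.IsBipartite) {y : V → R} (hy : y ᵥ* edgeIncMatrix R G = 0) :
    y = 0 := by
  have hadj : ∀ {i j}, G.Adj i j → y j = -y i := fun {i j} h => by
    rw [eq_neg_iff_add_eq_zero, add_comm, ← vecMul_edgeIncMatrix y h, hy, Pi.zero_apply]
  have hwalk : ∀ {u v} (_ : G.Walk u v), y u ≠ 0 → y v ≠ 0 := fun p hu => by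
    induction p with
    | nil => exact hu
    | cons h _ ih => exact ih (by simpa [hadj h] using hu)
  by_contra hne
  obtain ⟨u, hu⟩ := Function.ne_iff.mp hne
  refine hnb ⟨SimpleGraph.Coloring.mk (fun v => if 0 < y v then 0 else 1) fun {i j} h => ?_⟩
  rcases lt_or_gt_of_ne (hwalk (hconn u i).some hu) with hi | hi <;>
    simp [hadj h, hi, hi.not_gt]

theorem exists_signing_of_isBipartite_component (R : Type*) [Ring R] [LinearOrder R]
    [IsStrictOrderedRing R] {W : Type*} {H : SimpleGraph W} {c : H.ConnectedComponent}
    (hc : c.toSimpleGraph.IsBipartite) :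
    ∃ k : W → R, k ≠ 0 ∧ (∀ v, |k v| ≤ 1) ∧ ∀ i j, H.Adj i j → k i + k j = 0 := by
  classical
  obtain ⟨C⟩ := hc
  refine ⟨fun v => if hv : v ∈ c.supp then (if C ⟨v, hv⟩ = 0 then 1 else -1) else 0, ?_, ?_, ?_⟩
  · obtain ⟨w, hw⟩ := c.nonempty_supp
    refine Function.ne_iff.mpr ⟨w, ?_⟩
    rw [dif_pos hw]
    split_ifs <;> simp
  · intro v
    dsimp only
    split_ifs <;> simp
  · intro i j hij
    by_cases hi : i ∈ c.supp
    · have hj := (c.mem_supp_congr_adj hij).mp hi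
      have hne : C ⟨i, hi⟩ ≠ C ⟨j, hj⟩ := C.valid hij
      simp only [dif_pos hi, dif_pos hj]
      split_ifs with h₁ h₂ h₂
      · exact absurd (h₁.trans h₂.symm) hne
      · simp
      · simp
      · omega
    · simp [hi, mt (c.mem_supp_congr_adj hij).mpr hi]

variable {I J : Finset V}

section signVec

omit [Fintype V]

theorem signVec_of_mem_left [Ring R] (hIJ : Disjoint I J) {v : V} (hv : v ∈ I) :
    signVec R I J v = 1 := by
  simp [signVec, hv, Finset.disjoint_left.mp hIJ hv]

theorem signVec_of_mem_right [Ring R] (hIJ : Disjoint I J) {v : V} (hv : v ∈ J) :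
    signVec R I J v = -1 := by
  simp [signVec, hv, Finset.disjoint_right.mp hIJ hv]

theorem signVec_of_notMem [Ring R] {v : V} (hv : v ∉ I ∪ J) : signVec R I J v = 0 := by
  rw [Finset.notMem_union] at hv
  simp [signVec, hv]

theorem signVec_ne_zero [Ring R] [Nontrivial R] (hIJ : Disjoint I J) {v : V} (hv : v ∈ I ∪ J) :
    signVec R I J v ≠ 0 := by
  rcases Finset.mem_union.mp hv with h | h
  · simp [signVec_of_mem_left hIJ h]
  · simp [signVec_of_mem_right hIJ h]

theorem signVec_dotProduct [Fintype V] [Ring R] (s : V → R) :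
    signVec R I J ⬝ᵥ s = ∑ i ∈ I, s i - ∑ j ∈ J, s j := by
  simp [dotProduct, signVec, sub_mul, Finset.sum_sub_distrib]

end signVec

section Elementary

variable [Field R] [LinearOrder R] [IsStrictOrderedRing R]

theorem isConformal_signVec_extreme {y : V → R} {m : R} (hm : ∀ v, |y v| ≤ m) :
    IsConformal (signVec R {v | y v = m} {v | y v = -m} ᵥ* edgeIncMatrix R G)
      (y ᵥ* edgeIncMatrix R G) := by
  rw [isConformal_vecMul_edgeIncMatrix]
  intro i j _
  have hi := abs_le.mp (hm i)
  have hj := abs_le.mp (hm j)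
  simp only [signVec, Finset.mem_filter, Finset.mem_univ, true_and]
  grind

theorem isConformal_indicator_signVec (hIJ : Disjoint I J) {S : Set V} [DecidablePred (· ∈ S)]
    (hS : ∀ i j, (crossSubgraph G I J).Adj i j → (i ∈ S ↔ j ∈ S)) :
    IsConformal ((fun v => if v ∈ S then signVec R I J v else 0) ᵥ* edgeIncMatrix R G)
      (signVec R I J ᵥ* edgeIncMatrix R G) := by
  rw [isConformal_vecMul_edgeIncMatrix]
  intro i j hij
  have hcross : (i ∈ I ∧ j ∈ J) ∨ (i ∈ J ∧ j ∈ I) → (i ∈ S ↔ j ∈ S) := fun h => hS i j ⟨hij, h⟩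
  have hi : i ∈ I → i ∉ J := fun h => Finset.disjoint_left.mp hIJ h
  have hj : j ∈ I → j ∉ J := fun h => Finset.disjoint_left.mp hIJ h
  simp only [signVec]
  grind

theorem isConformal_signVec_add (hIJ : Disjoint I J) {k : V → R} (hk1 : ∀ v, |k v| ≤ 1)
    (hk0 : ∀ v ∈ I ∪ J, k v = 0)
    (hk : ∀ i j, G.Adj i j → i ∉ I ∪ J → j ∉ I ∪ J → k i + k j = 0) :
    IsConformal ((signVec R I J + k) ᵥ* edgeIncMatrix R G)
      (signVec R I J ᵥ* edgeIncMatrix R G) := by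
  rw [isConformal_vecMul_edgeIncMatrix]
  intro i j hij
  have hi := abs_le.mp (hk1 i)
  have hj := abs_le.mp (hk1 j)
  have hk := hk i j hij
  have hki := hk0 i
  have hkj := hk0 j
  have hi' : i ∈ I → i ∉ J := fun h => Finset.disjoint_left.mp hIJ h
  have hj' : j ∈ I → j ∉ J := fun h => Finset.disjoint_left.mp hIJ h
  simp only [signVec, Pi.add_apply, Finset.mem_union] at *
  grind

theorem connected_crossSubgraph_of_isElementary (hIJ : Disjoint I J) (hne : (I ∪ J).Nonempty)
    (hel : IsElementary (edgeIncMatrix R G) (signVec R I J)) :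
    (crossSubgraph G I J).Connected := by
  classical
  obtain ⟨u, hu⟩ := hne
  let c := (crossSubgraph G I J).coe.connectedComponentMk ⟨u, hu⟩
  let S : Set V := Subtype.val '' c.supp
  have hcross : ∀ i j, (crossSubgraph G I J).Adj i j → i ∈ S → j ∈ S := by
    rintro _ j hij ⟨i, hi, rfl⟩
    exact ⟨⟨j, hij.snd_mem⟩, (c.mem_supp_congr_adj hij.coe).mp hi, rfl⟩
  have huS : u ∈ S := ⟨⟨u, hu⟩, rfl, rfl⟩
  obtain ⟨d, -, hd⟩ := hel (fun v => if v ∈ S then signVec R I J v else 0)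
    (Function.ne_iff.mpr ⟨u, by simpa [huS] using signVec_ne_zero hIJ hu⟩)
    (isConformal_indicator_signVec hIJ fun i j hij => ⟨hcross i j hij, hcross j i hij.symm⟩)
  refine SimpleGraph.Subgraph.connected_iff'.mpr
    ((SimpleGraph.connected_iff_exists_forall_reachable _).mpr ⟨⟨u, hu⟩, fun ⟨v, hv⟩ => ?_⟩)
  by_contra hreach
  have hvS : v ∉ S := fun ⟨w, hw, hwv⟩ =>
    hreach (by subst hwv; exact (SimpleGraph.ConnectedComponent.exact hw).symm)
  have hv0 : signVec R I J v = 0 := by simpa [hvS] using congrFun hd v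
  exact signVec_ne_zero hIJ hv hv0

theorem not_isBipartite_component_of_isElementary (hIJ : Disjoint I J) (hne : (I ∪ J).Nonempty)
    (hel : IsElementary (edgeIncMatrix R G) (signVec R I J))
    (c : (G.induce {x | x ∉ I ∪ J}).ConnectedComponent) : ¬ c.toSimpleGraph.IsBipartite := by
  intro hc
  obtain ⟨k, hk, hk1, hadj⟩ := exists_signing_of_isBipartite_component R hc
  let k' : V → R := fun v => if hv : v ∉ I ∪ J then k ⟨v, hv⟩ else 0
  have hk'0 : ∀ v ∈ I ∪ J, k' v = 0 := fun v hv => dif_neg (not_not.mpr hv)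
  have hk' : ∀ v (hv : v ∉ I ∪ J), k' v = k ⟨v, hv⟩ := fun v hv => dif_pos hv
  obtain ⟨u, hu⟩ := hne
  obtain ⟨d, hd, heq⟩ := hel (signVec R I J + k')
    (Function.ne_iff.mpr ⟨u, by
      simpa [hk'0 u hu] using signVec_ne_zero hIJ hu⟩)
    (isConformal_signVec_add hIJ
      (fun v => by
        by_cases hv : v ∈ I ∪ J
        · simp [hk'0 v hv]
        · simpa [hk' v hv] using hk1 ⟨v, hv⟩)
      hk'0
      (fun i j hij hi hj => by
        rw [hk' i hi, hk' j hj]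
        exact hadj ⟨i, hi⟩ ⟨j, hj⟩ hij))
  refine hk (funext fun ⟨w, hw⟩ => ?_)
  have hw0 := congrFun heq w
  simpa [signVec_of_notMem hw, hd.ne', hk' w hw] using hw0

theorem IsElementary.exists_eq_smul_signVec {y : V → R}
    (hel : IsElementary (edgeIncMatrix R G) y) (hy : y ≠ 0) :
    ∃ (I J : Finset V) (c : R), Disjoint I J ∧ (I ∪ J).Nonempty ∧ 0 < c ∧ y = c • signVec R I J ∧
      IsElementary (edgeIncMatrix R G) (signVec R I J) := by
  obtain ⟨w, hw⟩ := Function.ne_iff.mp hy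
  obtain ⟨u, -, hu⟩ := Finset.exists_max_image Finset.univ (fun v => |y v|) ⟨w, Finset.mem_univ w⟩
  have hmax : ∀ v, |y v| ≤ |y u| := fun v => hu v (Finset.mem_univ v)
  have hpos : 0 < |y u| := (abs_pos.mpr hw).trans_le (hmax w)
  let I : Finset V := {v | y v = |y u|}
  let J : Finset V := {v | y v = -|y u|}
  have hIJ : Disjoint I J := Finset.disjoint_filter.mpr fun v _ h₁ h₂ => by linarith
  have huIJ : u ∈ I ∪ J := by
    simpa [I, J] using eq_or_eq_neg_of_abs_eq rfl
  have hne : signVec R I J ≠ 0 :=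
    Function.ne_iff.mpr ⟨u, signVec_ne_zero hIJ huIJ⟩
  obtain ⟨c, hc, hyc⟩ := hel _ hne (isConformal_signVec_extreme hmax)
  exact ⟨I, J, c, hIJ, ⟨u, huIJ⟩, hc, hyc,
    hel.of_isConformal hne (isConformal_signVec_extreme hmax)⟩

end Elementary

variable [DecidableRel G.Adj]

theorem edgeIncMatrix_mulVec_intCast [Ring R] (x : G.edgeSet → ℤ) :
    edgeIncMatrix R G *ᵥ (fun e => (x e : R)) = fun v => ((edgeIncMatrix ℤ G *ᵥ x) v : R) := by
  funext v
  simp [edgeIncMatrix, mulVec, dotProduct]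

theorem edgeIncMatrix_mulVec_eq_sum (x : G.edgeSet → ℤ) :
    edgeIncMatrix ℤ G *ᵥ x = ∑ e : G.edgeSet, x e • edgeVector (e : Sym2 V) := by
  funext v
  simp [edgeIncMatrix, mulVec, dotProduct, mul_comm]

/-- The right-hand side of the inequality attached to the sets `I` and `J`. -/
def cutCapacity [Ring R] (a b : G.edgeSet → R) (I J : Finset V) : R :=
  ∑ e ∈ edgesBetween G I (I ∪ J)ᶜ, b e + 2 * ∑ e ∈ edgesBetween G I I, b e
    - ∑ e ∈ edgesBetween G J (I ∪ J)ᶜ, a e - 2 * ∑ e ∈ edgesBetween G J J, a e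

theorem mk_mem_edgesBetween {A B : Finset V} {i j : V} (h : G.Adj i j) :
    (⟨s(i, j), h⟩ : G.edgeSet) ∈ edgesBetween G A B ↔ (i ∈ A ∧ j ∈ B) ∨ (j ∈ A ∧ i ∈ B) := by
  simp only [edgesBetween, Finset.mem_filter, Finset.mem_univ, true_and, Sym2.eq_iff]
  grind

theorem boxSupport_signVec [CommRing R] [LinearOrder R] [IsStrictOrderedRing R]
    (a b : G.edgeSet → R) (hIJ : Disjoint I J) :
    boxSupport a b (signVec R I J ᵥ* edgeIncMatrix R G) = cutCapacity a b I J := by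
  have hsum : ∀ (S : Finset G.edgeSet) (f : G.edgeSet → R),
      ∑ e ∈ S, f e = ∑ e, if e ∈ S then f e else 0 := fun S f => by simp
  simp only [cutCapacity, hsum (edgesBetween _ _ _), boxSupport, Finset.mul_sum,
    ← Finset.sum_add_distrib, ← Finset.sum_sub_distrib]
  refine Fintype.sum_congr _ _ (forall_edgeSet_iff.mpr fun i j h => ?_)
  have hi : i ∈ I → i ∉ J := fun h => Finset.disjoint_left.mp hIJ h
  have hj : j ∈ I → j ∉ J := fun h => Finset.disjoint_left.mp hIJ h
  simp only [mk_mem_edgesBetween, vecMul_edgeIncMatrix, Finset.mem_compl, Finset.mem_union, signVec]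
  by_cases i ∈ I <;> by_cases i ∈ J <;> by_cases j ∈ I <;> by_cases j ∈ J <;>
    simp_all [mul_comm] <;> norm_num

theorem signVec_dotProduct_mulVec_le [CommRing R] [LinearOrder R] [IsStrictOrderedRing R]
    {a b x : G.edgeSet → R} (hx : x ∈ Set.Icc a b) (hIJ : Disjoint I J) :
    signVec R I J ⬝ᵥ (edgeIncMatrix R G *ᵥ x) ≤ cutCapacity a b I J := by
  rw [dotProduct_mulVec, dotProduct_comm, ← boxSupport_signVec a b hIJ]
  exact dotProduct_le_boxSupport hx

theorem exists_mulVec_edgeIncMatrix_eq (hconn : G.Connected) (hnb : ¬ G.IsBipartite)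
    {a b : G.edgeSet → ℝ} (hab : a ≤ b) {s : V → ℝ}
    (hcut : ∀ I J : Finset V, Disjoint I J → (crossSubgraph G I J).Connected →
      (∀ c : (G.induce {x | x ∉ I ∪ J}).ConnectedComponent, ¬ c.toSimpleGraph.IsBipartite) →
      signVec ℝ I J ⬝ᵥ s ≤ cutCapacity a b I J) :
    ∃ x ∈ Set.Icc a b, edgeIncMatrix ℝ G *ᵥ x = s := by
  by_contra! hno
  obtain ⟨y, hel, hlt⟩ := exists_isElementary_boxSupport_lt
    (fun _ => eq_zero_of_vecMul_edgeIncMatrix_eq_zero hconn hnb)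
    (exists_boxSupport_vecMul_lt _ hab hno)
  have hy : y ≠ 0 := by
    rintro rfl
    simp [boxSupport] at hlt
  obtain ⟨I, J, c, hIJ, hne, hc, rfl, hel'⟩ := hel.exists_eq_smul_signVec hy
  rw [smul_vecMul, boxSupport_smul hc.le, smul_dotProduct, smul_eq_mul,
    boxSupport_signVec a b hIJ] at hlt
  exact (lt_of_mul_lt_mul_left hlt hc.le).not_ge (hcut I J hIJ
    (connected_crossSubgraph_of_isElementary hIJ hne hel')
    (not_isBipartite_component_of_isElementary hIJ hne hel'))

end Cut

section Rounding

open Matrix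

variable {V ι 𝕜 : Type*}

/-- The columns of `A` at the non-integral entries of `x` are linearly independent. The integers
are encoded as the least subring `⊥` of `𝕜`. -/
def FractionalColumnsIndependent [Fintype ι] [Ring 𝕜] (A : Matrix V ι 𝕜) (x : ι → 𝕜) : Prop :=
  ∀ w, A *ᵥ w = 0 → (∀ e, w e ≠ 0 → x e ∉ (⊥ : Subring 𝕜)) → w = 0

variable [Field 𝕜] [LinearOrder 𝕜] [IsStrictOrderedRing 𝕜]

theorem exists_floor_le_add_smul_le_ceil [Finite ι] [FloorRing 𝕜] {x w : ι → 𝕜} (hw : w ≠ 0)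
    (hx : ∀ e, w e ≠ 0 → x e ∉ (⊥ : Subring 𝕜)) :
    ∃ c : 𝕜, (∀ e, ⌊x e⌋ ≤ (x + c • w) e ∧ (x + c • w) e ≤ ⌈x e⌉) ∧
      ∃ e, x e ∉ (⊥ : Subring 𝕜) ∧ (x + c • w) e ∈ (⊥ : Subring 𝕜) := by
  let p : ι → 𝕜 := fun e => if 0 < w e then ⌈x e⌉ - x e else ⌊x e⌋ - x e
  have hpos : ∀ e, 0 < w e → p e = ⌈x e⌉ - x e := fun e h => if_pos h
  have hneg : ∀ e, w e ≤ 0 → p e = ⌊x e⌋ - x e := fun e h => if_neg h.not_gt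
  have hxint : ∀ e, x e + p e ∈ (⊥ : Subring 𝕜) := fun e => by
    rcases lt_or_ge 0 (w e) with h | h
    · simp [hpos e h]
    · simp [hneg e h]
  have hwp : IsConformal w p := fun e => by
    refine ⟨fun h => (?_ : 0 ≤ p e).lt_of_ne' ?_, fun h => (?_ : p e ≤ 0).lt_of_ne ?_⟩
    · simpa [hpos e h] using Int.le_ceil (x e)
    · exact fun h0 => hx e h.ne' (by simpa [h0] using hxint e)
    · simpa [hneg e h.le] using Int.floor_le (x e)
    · exact fun h0 => hx e h.ne (by simpa [h0] using hxint e)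
  obtain ⟨c, hc, hconf, e₀, he₀, he₀'⟩ := hwp.exists_sub_smul hw
  have hce₀ : p e₀ = (c • w) e₀ := sub_eq_zero.mp he₀'
  refine ⟨c, fun e => ?_, e₀, hx e₀ fun h => he₀ (by simp [hce₀, h]), by
    simpa [← hce₀] using hxint e₀⟩
  simp only [Pi.add_apply, Pi.smul_apply, smul_eq_mul]
  rcases lt_trichotomy (w e) 0 with h | h | h
  · have hp : p e - c * w e ≤ 0 := not_lt.mp fun h' => ((hwp e).2 h).not_gt ((hconf e).1 h')
    rw [hneg e h.le] at hp
    have hcw := mul_neg_of_pos_of_neg hc h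
    exact ⟨by linarith, by linarith [Int.le_ceil (x e)]⟩
  · simp [h, Int.floor_le, Int.le_ceil]
  · have hp : 0 ≤ p e - c * w e := not_lt.mp fun h' => ((hwp e).1 h).not_gt ((hconf e).2 h')
    rw [hpos e h] at hp
    have hcw := mul_pos hc h
    exact ⟨by linarith [Int.floor_le (x e)], by linarith⟩

theorem exists_fractionalColumnsIndependent [Fintype ι] [FloorRing 𝕜] (A : Matrix V ι 𝕜)
    {a b : ι → ℤ} {s : V → 𝕜}
    (hex : ∃ x ∈ Set.Icc (fun e => (a e : 𝕜)) (fun e => (b e : 𝕜)), A *ᵥ x = s) :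
    ∃ x ∈ Set.Icc (fun e => (a e : 𝕜)) (fun e => (b e : 𝕜)),
      A *ᵥ x = s ∧ FractionalColumnsIndependent A x := by
  obtain ⟨x, ⟨hx, hxs⟩, hmin⟩ := exists_minimalFor_of_wellFoundedLT
    (fun x => x ∈ Set.Icc (fun e => (a e : 𝕜)) (fun e => (b e : 𝕜)) ∧ A *ᵥ x = s)
    (fun x => {e | x e ∉ (⊥ : Subring 𝕜)}) hex
  refine ⟨x, hx, hxs, fun w hw hwx => ?_⟩
  by_contra hne
  obtain ⟨c, hc, e, he, he'⟩ := exists_floor_le_add_smul_le_ceil hne hwx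
  refine hmin (j := x + c • w) ⟨⟨fun i => ?_, fun i => ?_⟩, ?_⟩ (fun i hi => ?_) he he'
  · exact (Int.cast_le.mpr (Int.le_floor.mpr (hx.1 i))).trans (hc i).1
  · exact (hc i).2.trans (Int.cast_le.mpr (Int.ceil_le.mpr (hx.2 i)))
  · rw [mulVec_add, mulVec_smul, hw, smul_zero, add_zero, hxs]
  · by_cases hwi : w i = 0
    · simpa [hwi] using hi
    · exact hwx i hwi

end Rounding

section AlternatingWalk

open Matrix

variable {V R : Type*} [DecidableEq V] [CommRing R] {H : SimpleGraph V}

/-- The sum of the edges of a walk with alternating signs, as a weight on all pairs of vertices. -/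
def altSum (R : Type*) [Ring R] : ∀ {u v : V}, H.Walk u v → Sym2 V → R
  | _, _, .nil => 0
  | _, _, .cons (u := u) (v := v) _ p => Pi.single s(u, v) 1 - altSum R p

theorem altSum_append {u v w : V} (p : H.Walk u v) (q : H.Walk v w) :
    altSum R (p.append q) = altSum R p + (-1 : R) ^ p.length • altSum R q := by
  induction p with
  | nil => simp [altSum]
  | cons h p ih =>
    simp only [SimpleGraph.Walk.cons_append, altSum, ih, SimpleGraph.Walk.length_cons, pow_succ]
    module

theorem altSum_mem_bot {u v : V} (p : H.Walk u v) (e : Sym2 V) :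
    altSum R p e ∈ (⊥ : Subring R) := by
  induction p with
  | nil => exact zero_mem _
  | @cons i j _ _ p ih =>
    refine sub_mem ?_ ih
    rw [Pi.single_apply]
    split_ifs
    exacts [one_mem _, zero_mem _]

theorem altSum_eq_zero {u v : V} (p : H.Walk u v) {e : Sym2 V} (he : e ∉ p.edges) :
    altSum R p e = 0 := by
  induction p with
  | nil => rfl
  | cons _ p ih =>
    rw [SimpleGraph.Walk.edges_cons, List.mem_cons, not_or] at he
    simp [altSum, ih he.2, he.1]

theorem altSum_ne_zero [Nontrivial R] {u v : V} {p : H.Walk u v} (hp : p.IsTrail) {e : Sym2 V}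
    (he : e ∈ p.edges) : altSum R p e ≠ 0 := by
  induction p with
  | nil => simp at he
  | cons _ p ih =>
    rw [SimpleGraph.Walk.isTrail_cons] at hp
    rcases List.mem_cons.mp he with rfl | he
    · simp [altSum, altSum_eq_zero p hp.2]
    · have hne := ne_of_mem_of_not_mem he hp.2
      simpa [altSum, hne] using ih hp.1 he

variable [Fintype V] {G : SimpleGraph V} [DecidableRel G.Adj]

theorem edgeIncMatrix_mulVec_single {u v : V} (h : G.Adj u v) :
    edgeIncMatrix R G *ᵥ ((Pi.single s(u, v) 1 : Sym2 V → R) ∘ (↑) : G.edgeSet → R) =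
      Pi.single u 1 + Pi.single v 1 := by
  have hsingle : ((Pi.single s(u, v) 1 : Sym2 V → R) ∘ (↑) : G.edgeSet → R) =
      Pi.single ⟨s(u, v), h⟩ 1 := by
    funext e
    simp [Pi.single_apply, Subtype.ext_iff]
  rw [hsingle, mulVec_single_one]
  exact funext fun w => edgeIncMatrix_apply w h

theorem edgeIncMatrix_mulVec_altSum (hHG : H ≤ G) {u v : V} (p : H.Walk u v) :
    edgeIncMatrix R G *ᵥ (altSum R p ∘ (↑) : G.edgeSet → R) =
      Pi.single u 1 - (-1 : R) ^ p.length • Pi.single v 1 := by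
  induction p with
  | nil => simp [altSum, Pi.zero_comp]
  | @cons i j _ h p ih =>
    have hsub : (altSum R (p.cons h) ∘ (↑) : G.edgeSet → R) =
        ((Pi.single s(i, j) 1 : Sym2 V → R) ∘ (↑)) - (altSum R p ∘ (↑) : G.edgeSet → R) := rfl
    rw [hsub, mulVec_sub, ih, edgeIncMatrix_mulVec_single (hHG h), SimpleGraph.Walk.length_cons,
      pow_succ]
    module

theorem sum_edgeIncMatrix_mulVec (x : G.edgeSet → R) :
    ∑ v, (edgeIncMatrix R G *ᵥ x) v = 2 * ∑ e, x e := by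
  have hcol : (1 : V → R) ᵥ* edgeIncMatrix R G = fun _ => 2 :=
    funext (forall_edgeSet_iff.mpr fun i j h => by
      rw [vecMul_edgeIncMatrix 1 h, Pi.one_apply, Pi.one_apply, one_add_one_eq_two])
  rw [← one_dotProduct, dotProduct_mulVec, hcol, dotProduct, Finset.mul_sum]

end AlternatingWalk

section FractionalGraph

open Matrix

variable {V 𝕜 : Type*} {G : SimpleGraph V}

theorem exists_ne_existsUnique_adj_of_isAcyclic [Finite V] {H : SimpleGraph V} (hH : H.IsAcyclic)
    {u v : V} (huv : H.Adj u v) : ∃ l₁ l₂, l₁ ≠ l₂ ∧ (∃! w, H.Adj l₁ w) ∧ ∃! w, H.Adj l₂ w := by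
  classical
  have := Fintype.ofFinite V
  let c := H.connectedComponentMk u
  have hv : v ∈ c := (c.mem_supp_congr_adj huv).mp rfl
  have : Nontrivial c := ⟨⟨u, rfl⟩, ⟨v, hv⟩, fun h => huv.ne (congrArg Subtype.val h)⟩
  have hleaf : ∀ l : c, c.toSimpleGraph.degree l = 1 → ∃! w, H.Adj l w := fun l hl => by
    obtain ⟨w, hw, huniq⟩ := SimpleGraph.degree_eq_one_iff_existsUnique_adj.mp hl
    refine ⟨w, hw, fun w' hw' => congrArg Subtype.val
      (huniq ⟨w', (c.mem_supp_congr_adj hw').mp l.2⟩ hw')⟩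
  obtain ⟨l₁, l₂, hne, h₁, h₂⟩ := (hH.isTree_connectedComponent c).exists_ne_and_degree_eq_one
  exact ⟨l₁, l₂, Subtype.coe_ne_coe.mpr hne, hleaf l₁ h₁, hleaf l₂ h₂⟩

/-- The graph of the edges on which `x` is not an integer. -/
def fracGraph [Ring 𝕜] (x : G.edgeSet → 𝕜) : SimpleGraph V :=
  .fromEdgeSet {e | ∃ h : e ∈ G.edgeSet, x ⟨e, h⟩ ∉ (⊥ : Subring 𝕜)}

section CommRing

variable [CommRing 𝕜] {x : G.edgeSet → 𝕜}

theorem mem_edgeSet_fracGraph {e : Sym2 V} :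
    e ∈ (fracGraph x).edgeSet ↔ ∃ h : e ∈ G.edgeSet, x ⟨e, h⟩ ∉ (⊥ : Subring 𝕜) := by
  rw [fracGraph, SimpleGraph.edgeSet_fromEdgeSet]
  exact ⟨fun h => h.1, fun h => ⟨h, G.not_isDiag_of_mem_edgeSet h.1⟩⟩

theorem fracGraph_le (x : G.edgeSet → 𝕜) : fracGraph x ≤ G :=
  SimpleGraph.edgeSet_subset_edgeSet.mp fun _ h => (mem_edgeSet_fracGraph.mp h).1

theorem fracGraph_add_smul_altSum_le [DecidableEq V] {u v : V} (p : (fracGraph x).Walk u v)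
    (t : 𝕜) :
    fracGraph (x + t • (altSum 𝕜 p ∘ (↑))) ≤ fracGraph x := by
  refine SimpleGraph.edgeSet_subset_edgeSet.mp fun e he => ?_
  by_cases hep : e ∈ p.edges
  · exact p.edges_subset_edgeSet hep
  · simpa [mem_edgeSet_fracGraph, altSum_eq_zero p hep] using he

variable [Fintype V] [DecidableEq V] [DecidableRel G.Adj]

theorem mem_bot_of_isAcyclic_fracGraph (hac : (fracGraph x).IsAcyclic) {r : V}
    (hr : ∀ v ≠ r, (edgeIncMatrix 𝕜 G *ᵥ x) v ∈ (⊥ : Subring 𝕜)) (e : G.edgeSet) :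
    x e ∈ (⊥ : Subring 𝕜) := by
  revert e
  rw [forall_edgeSet_iff]
  intro i j hij
  by_contra hx
  obtain ⟨l₁, l₂, hne, h₁, h₂⟩ := exists_ne_existsUnique_adj_of_isAcyclic hac
    (mem_edgeSet_fracGraph.mpr ⟨hij, hx⟩)
  obtain ⟨l, hl, w, hlw, huniq⟩ : ∃ l ≠ r, ∃! w, (fracGraph x).Adj l w := by
    rcases eq_or_ne l₁ r with rfl | h
    exacts [⟨l₂, hne.symm, h₂⟩, ⟨l₁, h, h₁⟩]
  obtain ⟨hlwG, hxlw⟩ := mem_edgeSet_fracGraph.mp ((fracGraph x).mem_edgeSet.mpr hlw)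
  have hxl : x ⟨s(l, w), hlwG⟩ = (edgeIncMatrix 𝕜 G *ᵥ x) l -
      ∑ e ∈ Finset.univ.erase ⟨s(l, w), hlwG⟩, edgeIncMatrix 𝕜 G l e * x e := by
    rw [mulVec, dotProduct, ← Finset.add_sum_erase _ _ (Finset.mem_univ ⟨s(l, w), hlwG⟩)]
    simp [edgeIncMatrix_apply l hlwG, hlw.ne]
  rw [hxl] at hxlw
  refine hxlw (sub_mem (hr l hl) (sum_mem fun ⟨e, heG⟩ he => ?_))
  by_cases hle : l ∈ e
  · obtain ⟨w', rfl⟩ := hle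
    refine mul_mem (intCast_mem _ _) (by_contra fun hxe => Finset.ne_of_mem_erase he ?_)
    obtain rfl : w' = w := huniq w' (mem_edgeSet_fracGraph.mpr ⟨heG, hxe⟩)
    rfl
  · simp [edgeIncMatrix_apply_of_notMem heG hle]

theorem altSum_eq_zero_of_even (hx : FractionalColumnsIndependent (edgeIncMatrix 𝕜 G) x) {u : V}
    {p : (fracGraph x).Walk u u} (hp : Even p.length) : altSum 𝕜 p = 0 := by
  have hzero : (altSum 𝕜 p ∘ (↑) : G.edgeSet → 𝕜) = 0 := by
    refine hx _ ?_ fun e he => ?_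
    · rw [edgeIncMatrix_mulVec_altSum (fracGraph_le x), hp.neg_one_pow, one_smul, sub_self]
    · have hep : (e : Sym2 V) ∈ p.edges := by_contra fun h => he (altSum_eq_zero p h)
      exact (mem_edgeSet_fracGraph.mp (p.edges_subset_edgeSet hep)).2
  funext e
  by_cases he : e ∈ p.edges
  · exact congrFun hzero ⟨e, SimpleGraph.edgeSet_mono (fracGraph_le x) (p.edges_subset_edgeSet he)⟩
  · exact altSum_eq_zero p he

theorem odd_length_of_isCycle_fracGraph [Nontrivial 𝕜]
    (hx : FractionalColumnsIndependent (edgeIncMatrix 𝕜 G) x) {u : V}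
    {C : (fracGraph x).Walk u u} (hC : C.IsCycle) : Odd C.length := by
  rw [← Nat.not_even_iff_odd]
  intro heven
  obtain ⟨e, he⟩ := List.exists_mem_of_ne_nil _ (mt SimpleGraph.Walk.edges_eq_nil.mp hC.not_nil)
  exact altSum_ne_zero hC.isTrail he (congrFun (altSum_eq_zero_of_even hx heven) e)

theorem edges_subset_of_isCycle_fracGraph [Nontrivial 𝕜]
    (hx : FractionalColumnsIndependent (edgeIncMatrix 𝕜 G) x) {u v w : V}
    {C : (fracGraph x).Walk u u} {D : (fracGraph x).Walk v v} (hC : C.IsCycle) (hD : D.IsCycle)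
    (hwC : w ∈ C.support) (hwD : w ∈ D.support) : C.edges ⊆ D.edges := by
  intro e he
  by_contra heD
  have heven : Even ((C.rotate w hwC).append (D.rotate w hwD)).length := by
    rw [SimpleGraph.Walk.length_append, SimpleGraph.Walk.length_rotate,
      SimpleGraph.Walk.length_rotate]
    exact (odd_length_of_isCycle_fracGraph hx hC).add_odd (odd_length_of_isCycle_fracGraph hx hD)
  have hsum := congrFun (altSum_eq_zero_of_even hx heven) e
  rw [altSum_append, Pi.add_apply, Pi.smul_apply,
    altSum_eq_zero _ (mt (D.rotate_edges w hwD).mem_iff.mp heD), smul_zero, add_zero] at hsum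
  exact altSum_ne_zero (hC.rotate hwC).isTrail ((C.rotate_edges w hwC).mem_iff.mpr he) hsum

end CommRing

section Field

variable [Fintype V] [DecidableEq V] [DecidableRel G.Adj] [Field 𝕜] {x : G.edgeSet → 𝕜}

/-- Cancelling one edge of an odd cycle destroys every fractional cycle, since they all share it. -/
theorem exists_isAcyclic_fracGraph_add_smul_altSum
    (hx : FractionalColumnsIndependent (edgeIncMatrix 𝕜 G) x) {u : V}
    {C : (fracGraph x).Walk u u} (hC : C.IsCycle)
    (hmeet : ∀ (v : V) (D : (fracGraph x).Walk v v), D.IsCycle → ∃ w ∈ C.support, w ∈ D.support) :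
    ∃ t : 𝕜, (fracGraph (x + t • (altSum 𝕜 C ∘ (↑)))).IsAcyclic := by
  obtain ⟨e, he⟩ := List.exists_mem_of_ne_nil _ (mt SimpleGraph.Walk.edges_eq_nil.mp hC.not_nil)
  obtain ⟨heG, -⟩ := mem_edgeSet_fracGraph.mp (C.edges_subset_edgeSet he)
  refine ⟨-(x ⟨e, heG⟩ / altSum 𝕜 C e), fun v D hD => ?_⟩
  have hle := fracGraph_add_smul_altSum_le C (-(x ⟨e, heG⟩ / altSum 𝕜 C e))
  obtain ⟨w, hwC, hwD⟩ := hmeet v (D.mapLe hle) (hD.mapLe hle)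
  have heD := edges_subset_of_isCycle_fracGraph hx hC (hD.mapLe hle) hwC hwD he
  rw [SimpleGraph.Walk.edges_mapLe_eq_edges] at heD
  obtain ⟨_, hnot⟩ := mem_edgeSet_fracGraph.mp (D.edges_subset_edgeSet heD)
  exact hnot (by simp [altSum_ne_zero hC.isTrail he])

theorem mem_bot_of_isCycle_fracGraph [CharZero 𝕜]
    (hx : FractionalColumnsIndependent (edgeIncMatrix 𝕜 G) x) {u : V}
    {C : (fracGraph x).Walk u u} (hC : C.IsCycle)
    (hmeet : ∀ (v : V) (D : (fracGraph x).Walk v v), D.IsCycle → ∃ w ∈ C.support, w ∈ D.support)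
    {s : V → ℤ} (hs : edgeIncMatrix 𝕜 G *ᵥ x = fun v => (s v : 𝕜)) (heven : Even (∑ v, s v))
    (e : G.edgeSet) : x e ∈ (⊥ : Subring 𝕜) := by
  obtain ⟨t, hac⟩ := exists_isAcyclic_fracGraph_add_smul_altSum hx hC hmeet
  set y : G.edgeSet → 𝕜 := x + t • (altSum 𝕜 C ∘ (↑)) with hy
  have hysum : edgeIncMatrix 𝕜 G *ᵥ y = (fun v => (s v : 𝕜)) + (2 * t) • Pi.single u 1 := by
    rw [hy, mulVec_add, mulVec_smul, hs, edgeIncMatrix_mulVec_altSum (fracGraph_le x),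
      (odd_length_of_isCycle_fracGraph hx hC).neg_one_pow]
    module
  have hyint : ∀ e, y e ∈ (⊥ : Subring 𝕜) := mem_bot_of_isAcyclic_fracGraph hac (r := u)
    fun v hv => by simp [hysum, hv]
  have htint : t ∈ (⊥ : Subring 𝕜) := by
    obtain ⟨k, hk⟩ := heven
    have hk' : ∑ v, (s v : 𝕜) = k + k := mod_cast hk
    have hsum := sum_edgeIncMatrix_mulVec y
    simp only [hysum, Pi.add_apply, Pi.smul_apply, Finset.sum_add_distrib, smul_eq_mul,
      ← Finset.mul_sum, Finset.sum_pi_single', Finset.mem_univ, if_true, hk'] at hsum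
    have ht : t = ∑ e, y e - k := mul_left_cancel₀ two_ne_zero (by linear_combination hsum)
    rw [ht]
    exact sub_mem (sum_mem fun e _ => hyint e) (intCast_mem _ k)
  have hxe : x e = y e - t * altSum 𝕜 C e := by simp [hy]
  rw [hxe]
  exact sub_mem (hyint e) (mul_mem htint (altSum_mem_bot C e))

theorem exists_int_mulVec_edgeIncMatrix_eq [LinearOrder 𝕜] [IsStrictOrderedRing 𝕜]
    [FloorRing 𝕜]
    (hmeet : ∀ (c d : V) (C : G.Walk c c) (D : G.Walk d d), C.IsCycle → Odd C.length →
      D.IsCycle → Odd D.length → ∃ w, w ∈ C.support ∧ w ∈ D.support)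
    {a b : G.edgeSet → ℤ} {s : V → ℤ} (heven : Even (∑ v, s v))
    (hex : ∃ x ∈ Set.Icc (fun e => (a e : 𝕜)) (fun e => (b e : 𝕜)),
      edgeIncMatrix 𝕜 G *ᵥ x = fun v => (s v : 𝕜)) :
    ∃ x ∈ Set.Icc a b, edgeIncMatrix ℤ G *ᵥ x = s := by
  obtain ⟨x, hxab, hxs, hx⟩ := exists_fractionalColumnsIndependent _ hex
  have hxint : ∀ e, x e ∈ (⊥ : Subring 𝕜) := by
    by_cases hac : (fracGraph x).IsAcyclic
    · exact forall_edgeSet_iff.mpr fun i j h =>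
        mem_bot_of_isAcyclic_fracGraph hac (r := i) (fun v _ => by simp [hxs]) _
    · simp only [SimpleGraph.IsAcyclic, not_forall, not_not] at hac
      obtain ⟨u, C, hC⟩ := hac
      refine mem_bot_of_isCycle_fracGraph hx hC (fun v D hD => ?_) hxs heven
      have hle := fracGraph_le x
      simpa using hmeet u v (C.mapLe hle) (D.mapLe hle) (hC.mapLe hle)
        (by simpa using odd_length_of_isCycle_fracGraph hx hC) (hD.mapLe hle)
        (by simpa using odd_length_of_isCycle_fracGraph hx hD)
  choose n hn using fun e => Subring.mem_bot.mp (hxint e)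
  obtain rfl : (fun e => (n e : 𝕜)) = x := funext hn
  rw [edgeIncMatrix_mulVec_intCast] at hxs
  exact ⟨n, ⟨fun e => Int.cast_le.mp (hxab.1 e), fun e => Int.cast_le.mp (hxab.2 e)⟩,
    funext fun v => Int.cast_injective (congrFun hxs v)⟩

end Field

end FractionalGraph

section Main

open Matrix

variable {V : Type*} {G : SimpleGraph V}

theorem exists_isPath_between (hconn : G.Connected) {S T : Set V} (hS : S.Nonempty)
    (hT : T.Nonempty) :
    ∃ u ∈ S, ∃ v ∈ T, ∃ P : G.Walk u v, P.IsPath ∧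
      (∀ x ∈ P.support, x ∈ S → x = u) ∧ ∀ x ∈ P.support, x ∈ T → x = v := by
  classical
  obtain ⟨⟨u, v⟩, ⟨hu, hv⟩, hmin⟩ := exists_minimalFor_of_wellFoundedLT
    (fun p : V × V => p.1 ∈ S ∧ p.2 ∈ T) (fun p => G.dist p.1 p.2) ⟨(hS.some, hT.some),
      hS.some_mem, hT.some_mem⟩
  obtain ⟨P, hP, hlen⟩ := hconn.exists_path_of_dist u v
  have hle : ∀ {x y} (Q : G.Walk x y), x ∈ S → y ∈ T → P.length ≤ Q.length := fun {x y} Q hx hy =>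
    calc P.length = G.dist u v := hlen
      _ ≤ G.dist x y := not_lt.mp fun h => (hmin (j := (x, y)) ⟨hx, hy⟩ h.le).not_gt h
      _ ≤ Q.length := SimpleGraph.dist_le Q
  refine ⟨u, hu, v, hv, P, hP, fun x hxP hxS => ?_, fun x hxP hxT => ?_⟩
  · by_contra hne
    exact (SimpleGraph.Walk.length_dropUntil_lt_length hxP hne).not_ge (hle _ hxS hv)
  · by_contra hne
    exact (SimpleGraph.Walk.length_takeUntil_lt_length hxP hne).not_ge (hle _ hu hxT)

theorem hasConnectedOddCycles_of_disjoint_support (hconn : G.Connected) {c d : V} {C : G.Walk c c}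
    {D : G.Walk d d} (hC : C.IsCycle) (hCodd : Odd C.length) (hD : D.IsCycle)
    (hDodd : Odd D.length) (hdisj : C.support.Disjoint D.support) : HasConnectedOddCycles G := by
  obtain ⟨u, hu, v, hv, P, hP, hPC, hPD⟩ := exists_isPath_between hconn
    (S := {x | x ∈ C.support}) (T := {x | x ∈ D.support})
    ⟨c, C.start_mem_support⟩ ⟨d, D.start_mem_support⟩
  have hedges : C.edges.Disjoint D.edges := fun e heC heD => by
    induction e with
    | h i j => exact hdisj (C.fst_mem_support_of_mem_edges heC) (D.fst_mem_support_of_mem_edges heD)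
  exact ⟨c, d, u, v, C, D, P, hC, hCodd, hD, hDodd, hedges, hP,
    fun huv => hdisj hu (huv ▸ hv), hu, hv, hPC, hPD⟩

variable [Fintype V] [DecidableEq V] [DecidableRel G.Adj]

theorem cutCapacity_intCast {R : Type*} [Ring R] (a b : G.edgeSet → ℤ) (I J : Finset V) :
    cutCapacity (fun e => (a e : R)) (fun e => (b e : R)) I J = (cutCapacity a b I J : ℤ) := by
  simp only [cutCapacity]
  push_cast
  rfl

theorem theorem4p4_general (hconn : G.Connected) (hnb : ¬ G.IsBipartite)
    (hmeet : ∀ (c d : V) (C : G.Walk c c) (D : G.Walk d d), C.IsCycle → Odd C.length →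
      D.IsCycle → Odd D.length → ∃ w, w ∈ C.support ∧ w ∈ D.support)
    (s : V → ℤ) (a b : G.edgeSet → ℤ) (hab : ∀ e, a e ≤ b e) :
    (∃ x : G.edgeSet → ℤ, (∀ e, a e ≤ x e ∧ x e ≤ b e) ∧
        s = ∑ e : G.edgeSet, x e • edgeVector (e : Sym2 V)) ↔
      Even (∑ i, s i) ∧
      ∀ I J : Finset V, Disjoint I J →
        (crossSubgraph G I J).Connected →
        (∀ c : (G.induce {x | x ∉ I ∪ J}).ConnectedComponent,
          ¬ c.toSimpleGraph.IsBipartite) →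
        ∑ i ∈ I, s i - ∑ j ∈ J, s j ≤
          ∑ e ∈ edgesBetween G I (I ∪ J)ᶜ, b e + 2 * ∑ e ∈ edgesBetween G I I, b e
            - ∑ e ∈ edgesBetween G J (I ∪ J)ᶜ, a e - 2 * ∑ e ∈ edgesBetween G J J, a e := by
  simp_rw [← edgeIncMatrix_mulVec_eq_sum]
  constructor
  · rintro ⟨x, hx, rfl⟩
    refine ⟨⟨∑ e, x e, by rw [sum_edgeIncMatrix_mulVec, two_mul]⟩, fun I J hIJ _ _ => ?_⟩
    rw [← signVec_dotProduct]
    exact signVec_dotProduct_mulVec_le ⟨fun e => (hx e).1, fun e => (hx e).2⟩ hIJ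
  · rintro ⟨heven, hcut⟩
    have hreal : ∃ x ∈ Set.Icc (fun e => (a e : ℝ)) (fun e => (b e : ℝ)),
        edgeIncMatrix ℝ G *ᵥ x = fun v => (s v : ℝ) := by
      refine exists_mulVec_edgeIncMatrix_eq hconn hnb (fun e => Int.cast_le.mpr (hab e))
        fun I J hIJ hcross hcomp => ?_
      rw [cutCapacity_intCast, signVec_dotProduct]
      exact_mod_cast hcut I J hIJ hcross hcomp
    obtain ⟨x, hx, hxs⟩ := exists_int_mulVec_edgeIncMatrix_eq hmeet heven hreal
    exact ⟨x, fun e => ⟨hx.1 e, hx.2 e⟩, hxs.symm⟩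

end Main

theorem theorem4p4 {V : Type*} [Fintype V] [DecidableEq V] (G : SimpleGraph V)
    [DecidableRel G.Adj] (hconn : G.Connected) (hnb : ¬ G.IsBipartite)
    (hodd : ¬ HasConnectedOddCycles G)
    (s : V → ℤ) (a b : G.edgeSet → ℤ) (hab : ∀ e, a e ≤ b e) :
    (∃ x : G.edgeSet → ℤ, (∀ e, a e ≤ x e ∧ x e ≤ b e) ∧
        s = ∑ e : G.edgeSet, x e • edgeVector (e : Sym2 V)) ↔
      Even (∑ i, s i) ∧
      ∀ I J : Finset V, Disjoint I J →
        (crossSubgraph G I J).Connected →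
        (∀ c : (G.induce {x | x ∉ I ∪ J}).ConnectedComponent,
          ¬ c.toSimpleGraph.IsBipartite) →
        ∑ i ∈ I, s i - ∑ j ∈ J, s j ≤
          ∑ e ∈ edgesBetween G I (I ∪ J)ᶜ, b e + 2 * ∑ e ∈ edgesBetween G I I, b e
            - ∑ e ∈ edgesBetween G J (I ∪ J)ᶜ, a e - 2 * ∑ e ∈ edgesBetween G J J, a e := by
  refine theorem4p4_general hconn hnb (fun c d C D hC hCodd hD hDodd => ?_) s a b hab
  by_contra! hdisj
  exact hodd (hasConnectedOddCycles_of_disjoint_support hconn hC hCodd hD hDodd fun w => hdisj w)
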